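/- Let $\Delta_3$ be the standard $3$-dimensional simplex and $\partial\Delta_3$ its boundary (the union of its proper faces). Let $q\colon\Delta_3\to S^3$ be a map that collapses the boundary, that is, the quotient projection $\Delta_3\to\Delta_3/\partial\Delta_3$ followed by an arbitrary homeomorphism $\Delta_3/\partial\Delta_3\cong S^3$. Let $h\colon S^3\to S^2$ be the Hopf map, $h(z,w)=(2\,\mathrm{Re}(z\bar w),\,2\,\mathrm{Im}(z\bar w),\,|z|^2-|w|^2)$ on $S^3=\{(z,w)\in\mathbb C^2:|z|^2+|w|^2=1\}$, and let $f=h\circ q\colon\Delta_3\to S^2$. Then $f$ does not factor over $\mathbb R^2$: there are no continuous maps $f'\colon\Delta_3\to\mathbb R^2$ and $g\colon\mathbb R^2\to S^2$ with $f=g\circ f'$. -/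

import Mathlib

noncomputable section

namespace HopfSimplex

open Metric Topology

/-- The (geometric) standard `n`-simplex, with vertices indexed by `Fin (n + 1)`. -/
abbrev Simplex (n : ℕ) : Type := stdSimplex ℝ (Fin (n + 1))

/-- The boundary of the `n`-simplex: the union of its proper faces, i.e. the points at least one of
whose barycentric coordinates vanishes. -/
def simplexBoundary (n : ℕ) : Set (Simplex n) := {x | ∃ i, x.1 i = 0}

/-- The sphere `S³`, as the unit sphere of `ℂ²` (with its Hermitian norm). -/
abbrev S3 : Type := sphere (0 : EuclideanSpace ℂ (Fin 2)) 1

/-- The sphere `S²`, as the unit sphere of Euclidean `ℝ³`. -/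
abbrev S2 : Type := sphere (0 : EuclideanSpace ℝ (Fin 3)) 1

/-- `q : X → Y` collapses the subset `A` to a point: it is a topological quotient map whose only
identifications are those between points of `A`. Equivalently, `q` is the projection `X → X / A`
followed by a homeomorphism `X / A ≃ₜ Y`. -/
structure IsCollapse {X Y : Type*} [TopologicalSpace X] [TopologicalSpace Y]
    (A : Set X) (q : X → Y) : Prop where
  isQuotientMap : IsQuotientMap q
  eq_iff : ∀ x y, q x = q y ↔ x = y ∨ (x ∈ A ∧ y ∈ A)

/-- The formula `(z, w) ↦ (2 Re (z w̄), 2 Im (z w̄), |z|² - |w|²)`. -/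
def hopfVec (p : EuclideanSpace ℂ (Fin 2)) : EuclideanSpace ℝ (Fin 3) :=
  !₂[2 * (p 0 * starRingEnd ℂ (p 1)).re, 2 * (p 0 * starRingEnd ℂ (p 1)).im,
    ‖p 0‖ ^ 2 - ‖p 1‖ ^ 2]

theorem norm_hopfVec (p : EuclideanSpace ℂ (Fin 2)) (hp : p ∈ sphere 0 1) :
    hopfVec p ∈ sphere 0 1 := by
  rw [mem_sphere_zero_iff_norm, EuclideanSpace.norm_eq, Real.sqrt_eq_one] at hp ⊢
  simp only [Fin.sum_univ_two, Complex.sq_norm, Complex.normSq_apply] at hp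
  simp only [hopfVec, Fin.sum_univ_three, Real.norm_eq_abs, sq_abs, Complex.sq_norm,
    Complex.normSq_apply, Complex.mul_re, Complex.mul_im, Complex.conj_re, Complex.conj_im,
    PiLp.toLp_apply, Matrix.cons_val]
  calc _ = ((p 0).re * (p 0).re + (p 0).im * (p 0).im +
        ((p 1).re * (p 1).re + (p 1).im * (p 1).im)) ^ 2 := by ring
    _ = 1 := by rw [hp, one_pow]

/-- The Hopf map `S³ → S²`. -/
def hopfMap (p : S3) : S2 := ⟨hopfVec p, norm_hopfVec p p.2⟩

/-- The map `f : X → M` factors over `ℝᵈ`: it is a composite `X → ℝᵈ → M` of continuous maps. -/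
def FactorsOver (d : ℕ) {X M : Type*} [TopologicalSpace X] [TopologicalSpace M]
    (f : X → M) : Prop :=
  ∃ (f' : X → EuclideanSpace ℝ (Fin d)) (g : EuclideanSpace ℝ (Fin d) → M),
    Continuous f' ∧ Continuous g ∧ f = g ∘ f'

/-! The boundary of `Δ₃` can indeed be collapsed so as to obtain `S³`. -/

/-- The open simplex is parametrized by `ℝⁿ`. -/
def softmax (n : ℕ) : OpenPartialHomeomorph (Fin n → ℝ) (Simplex n) where
  toFun v := ⟨fun i => Real.exp ((Fin.cons 0 v : Fin (n + 1) → ℝ) i) /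
      ∑ j, Real.exp ((Fin.cons 0 v : Fin (n + 1) → ℝ) j),
    fun i => by positivity, by
      rw [← Finset.sum_div]
      exact div_self (by positivity)⟩
  invFun x := fun i => Real.log (x.1 i.succ) -
    Real.log (x.1 0)
  source := Set.univ
  target := (simplexBoundary n)ᶜ
  map_source' v _ := by
    rintro ⟨i, hi⟩
    have : 0 < Real.exp ((Fin.cons 0 v : Fin (n + 1) → ℝ) i) /
      ∑ j, Real.exp ((Fin.cons 0 v : Fin (n + 1) → ℝ) j) := by positivity
    exact this.ne' hi
  map_target' _ _ := Set.mem_univ _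
  left_inv' v _ := by
    ext i
    have h : (∑ j, Real.exp ((Fin.cons 0 v : Fin (n + 1) → ℝ) j)) ≠ 0 := by positivity
    change Real.log (Real.exp _ / _) - Real.log (Real.exp _ / _) = _
    rw [Real.log_div (Real.exp_ne_zero _) h, Real.log_div (Real.exp_ne_zero _) h]
    simp
  right_inv' x hx := by
    have hpos : ∀ i, 0 < x.1 i := fun i =>
      lt_of_le_of_ne (x.2.1 i) fun h => hx ⟨i, h.symm⟩
    have key : ∀ i, Real.exp ((Fin.cons 0 (fun i : Fin n =>
        Real.log (x.1 i.succ) - Real.log (x.1 0)) :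
          Fin (n + 1) → ℝ) i) = x.1 i / x.1 0 := by
      intro i
      refine Fin.cases ?_ (fun i => ?_) i
      · simp [(hpos 0).ne']
      · simp [Real.exp_sub, Real.exp_log (hpos _)]
    refine Subtype.ext (funext fun i => ?_)
    change Real.exp _ / ∑ j, Real.exp _ = _
    simp only [key]
    rw [← Finset.sum_div, x.2.2]
    field_simp [(hpos 0).ne']
  open_source := isOpen_univ
  open_target := by
    have : (simplexBoundary n)ᶜ = ⋂ i, {x : Simplex n | x.1 i ≠ 0} := by
      ext x
      simp [simplexBoundary]
    rw [this]
    exact isOpen_iInter_of_finite fun i => isOpen_ne_fun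
      ((continuous_apply i).comp continuous_subtype_val) continuous_const
  continuousOn_toFun := by
    refine Continuous.continuousOn (Continuous.subtype_mk (continuous_pi fun i => ?_) _)
    have hc : ∀ i, Continuous fun v : Fin n → ℝ =>
        Real.exp ((Fin.cons 0 v : Fin (n + 1) → ℝ) i) := by
      intro i
      refine Fin.cases ?_ (fun i => ?_) i
      · simpa using continuous_const
      · simpa using (continuous_apply i).rexp
    exact (hc i).div (continuous_finsetSum _ fun j _ => hc j) fun v => by positivity
  continuousOn_invFun := by
    refine continuousOn_pi.2 fun i => ContinuousOn.sub ?_ ?_ <;>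
    · refine ContinuousOn.log
        ((continuous_apply _).comp continuous_subtype_val).continuousOn fun x hx h => hx ⟨_, h⟩

theorem exists_isCollapse_onePoint {X K : Type*} [TopologicalSpace X] [TopologicalSpace K]
    [CompactSpace K] [T2Space K] [T2Space (OnePoint X)] {s : X → K} (hs : IsOpenEmbedding s)
    (hne : (Set.range s)ᶜ.Nonempty) :
    ∃ q : K → OnePoint X, IsCollapse (Set.range s)ᶜ q := by
  classical
  let q : K → OnePoint X := fun k => if h : k ∈ Set.range s then ((h.choose : X) : OnePoint X) else
    OnePoint.infty
  have q1 : ∀ x, q (s x) = (x : OnePoint X) := fun x => by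
    have h : s x ∈ Set.range s := ⟨x, rfl⟩
    simp only [q, dif_pos h]
    rw [hs.injective h.choose_spec]
  have q2 : ∀ k, k ∉ Set.range s → q k = OnePoint.infty := fun k h => by simp only [q, dif_neg h]
  have hcont : Continuous q := by
    refine continuous_def.2 fun t ht => ?_
    by_cases hi : OnePoint.infty ∈ t
    · have hk := ((OnePoint.isOpen_iff_of_mem hi).1 ht).2
      have : q ⁻¹' t = (s '' ((fun x : X => (x : OnePoint X)) ⁻¹' t)ᶜ)ᶜ := by
        ext k
        by_cases h : k ∈ Set.range s
        · obtain ⟨x, rfl⟩ := h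
          simp [q1, hs.injective.eq_iff]
        · simp only [Set.mem_preimage, q2 k h, hi, true_iff]
          rintro ⟨x, -, rfl⟩
          exact h ⟨x, rfl⟩
      rw [this]
      exact (hk.image hs.continuous).isClosed.isOpen_compl
    · have hk := (OnePoint.isOpen_iff_of_notMem hi).1 ht
      have : q ⁻¹' t = s '' ((fun x : X => (x : OnePoint X)) ⁻¹' t) := by
        ext k
        by_cases h : k ∈ Set.range s
        · obtain ⟨x, rfl⟩ := h
          simp [q1, hs.injective.eq_iff]
        · simp only [Set.mem_preimage, q2 k h, hi, false_iff]
          rintro ⟨x, -, rfl⟩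
          exact h ⟨x, rfl⟩
      rw [this]
      exact hs.isOpenMap _ hk
  have hsurj : Function.Surjective q := by
    intro y
    induction y using OnePoint.rec with
    | infty => exact ⟨hne.some, q2 _ hne.some_mem⟩
    | coe x => exact ⟨s x, q1 x⟩
  refine ⟨q, hcont.isClosedMap.isQuotientMap hcont hsurj, fun x y => ?_⟩
  by_cases hx : x ∈ Set.range s <;> by_cases hy : y ∈ Set.range s
  · obtain ⟨a, rfl⟩ := hx
    obtain ⟨b, rfl⟩ := hy
    simp [q1, hs.injective.eq_iff]
  · obtain ⟨a, rfl⟩ := hx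
    have : s a ≠ y := fun h => hy ⟨a, h⟩
    simp [q1, q2 y hy, this]
  · obtain ⟨b, rfl⟩ := hy
    have : x ≠ s b := fun h => hx ⟨b, h.symm⟩
    simp [q1, q2 x hx, this]
  · simp only [q2 x hx, q2 y hy, true_iff]
    exact Or.inr ⟨hx, hy⟩

theorem exists_isCollapse_simplexBoundary :
    ∃ q : Simplex 3 → S3, IsCollapse (simplexBoundary 3) q := by
  have hs : IsOpenEmbedding (softmax 3) := (softmax 3).isOpenEmbedding rfl
  have hr : (Set.range (softmax 3))ᶜ = simplexBoundary 3 := by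
    have := (softmax 3).image_source_eq_target
    rw [show (softmax 3).source = Set.univ from rfl, Set.image_univ] at this
    rw [this]
    exact compl_compl _
  have hne : (simplexBoundary 3).Nonempty :=
    ⟨⟨Pi.single 0 1, single_mem_stdSimplex ℝ 0⟩, 1, by simp⟩
  obtain ⟨q, hq⟩ := exists_isCollapse_onePoint hs (hr ▸ hne)
  rw [hr] at hq
  let v : EuclideanSpace ℂ (Fin 2) := EuclideanSpace.single 0 1
  have hv : ‖v‖ = 1 := by simp [v]
  have hv0 : v ≠ 0 := fun h => by simp [h] at hv
  have hfr : Module.finrank ℝ (EuclideanSpace ℂ (Fin 2)) = 3 + 1 := by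
    rw [← Module.finrank_mul_finrank ℝ ℂ (EuclideanSpace ℂ (Fin 2)), Complex.finrank_real_complex,
      finrank_euclideanSpace]
    rfl
  have : Fact (Module.finrank ℝ (EuclideanSpace ℂ (Fin 2)) = 3 + 1) := ⟨hfr⟩
  have hV : Module.finrank ℝ (Fin 3 → ℝ) = Module.finrank ℝ (Submodule.span ℝ {v})ᗮ := by
    rw [Submodule.finrank_orthogonal_span_singleton (n := 3) hv0]
    simp
  let e : (Fin 3 → ℝ) ≃ₜ (Submodule.span ℝ {v})ᗮ :=
    (FiniteDimensional.nonempty_continuousLinearEquiv_of_finrank_eq hV).some.toHomeomorph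
  let e' : OnePoint (Fin 3 → ℝ) ≃ₜ S3 :=
    e.onePointCongr.trans (onePointHyperplaneHomeoUnitSphere hv)
  exact ⟨e' ∘ q, e'.isQuotientMap.comp hq.isQuotientMap, fun x y => by
    simp only [Function.comp_apply, e'.injective.eq_iff, hq.eq_iff]⟩

end HopfSimplex

end

/-!
Suppose `hopfMap ∘ q = g ∘ f'`. As `ℝ²` is contractible, `g` is nullhomotopic, so over the compact
range of `f'` it lifts through the Hopf map to some `G` with values in `S³`; the lift is carried
along the homotopy by projecting a given lift to the nearby Hopf fibres, which works as long as the
two maps to `S²` are nowhere antipodal. Now `q` and `G ∘ f'` differ by a phase `exp (i θ)`, and `θ`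
is a continuous real function because the simplex is contractible. Hence `F = (f', θ)`, with values
in `ℝ² × ℝ`, separates all points that `q` separates: it is injective on the open simplex, whose
image is therefore open by invariance of domain. Choose a point `x₀` whose Hopf fibre misses the
collapsed boundary. On the line `{f' x₀} × ℝ` the compact image of the simplex agrees with the open
image of its interior, so it is open and closed in the line, hence the whole line: a contradiction.

Invariance of domain follows from Brouwer's fixed point theorem by Kulpa's argument, and Brouwer's
theorem from a volume computation of Milnor and Rogers: for a smooth `h` vanishing on the sphere,
`∫ det (1 + t Dh)` over the ball is polynomial in `t` and, for small `t`, equal to the volume of the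
ball, hence also for `t = 1`. This is absurd if `x + h x` has constant norm.
-/

namespace HopfSimplex

open Filter Function MeasureTheory Metric Module Polynomial Set Topology
open scoped NNReal

section Determinant

variable {E : Type*} [NormedAddCommGroup E] [NormedSpace ℝ E] [FiniteDimensional ℝ E]

theorem exists_polynomial_eval_eq_det_one_add_smul (A : E →L[ℝ] E) :
    ∃ p : ℝ[X], p.natDegree ≤ finrank ℝ E ∧
      ∀ t : ℝ, p.eval t = (1 + t • A : E →L[ℝ] E).det := by
  let b := finBasis ℝ E
  let M := LinearMap.toMatrix b b (A : E →ₗ[ℝ] E)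
  refine ⟨((X : ℝ[X]) • M.map C + (1 : Matrix _ _ ℝ).map C).det,
    by simpa only [Fintype.card_fin] using natDegree_det_X_add_C_le M 1, fun t => ?_⟩
  have hM : 1 + t • M = LinearMap.toMatrix b b (1 + t • A : E →L[ℝ] E) := by
    rw [ContinuousLinearMap.toLinearMap_add, ContinuousLinearMap.toLinearMap_smul, map_add,
      map_smul]
    exact congrArg (· + t • M) (LinearMap.toMatrix_one b).symm
  rw [ContinuousLinearMap.det, ← LinearMap.det_toMatrix b, ← hM, add_comm, ← coe_evalRingHom,
    RingHom.map_det]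
  congr 1
  ext i j
  simp [Matrix.one_apply, apply_ite (Polynomial.eval t), mul_comm t]

theorem exists_eval_one_eq_sum (d : ℕ) {ε : ℝ} (hε : 0 < ε) :
    ∃ (s : Finset ℝ) (w : ℝ → ℝ), (∀ t ∈ s, t ∈ Ioo 0 ε) ∧
      ∀ p : ℝ[X], p.natDegree ≤ d → p.eval 1 = ∑ t ∈ s, w t * p.eval t := by
  obtain ⟨s, hs, hcard⟩ := (Ioo_infinite hε).exists_subset_card_eq (d + 1)
  refine ⟨s, fun t => (Lagrange.basis s id t).eval 1, fun t ht => hs ht, fun p hp => ?_⟩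
  have hdeg : p.degree < s.card := by
    rw [hcard]
    exact degree_le_natDegree.trans_lt (by exact_mod_cast Nat.lt_succ_of_le hp)
  conv_lhs => rw [Lagrange.eq_interpolate (injOn_id _) hdeg]
  rw [Lagrange.interpolate_apply, eval_finsetSum]
  exact Finset.sum_congr rfl fun t _ => by rw [eval_mul, eval_C, id, mul_comm]

variable (E) in
theorem exists_det_one_add_eq_sum {ε : ℝ} (hε : 0 < ε) :
    ∃ (s : Finset ℝ) (w : ℝ → ℝ), (∀ t ∈ s, t ∈ Ioo 0 ε) ∧ ∑ t ∈ s, w t = 1 ∧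
      ∀ A : E →L[ℝ] E, (1 + A).det = ∑ t ∈ s, w t * (1 + t • A).det := by
  obtain ⟨s, w, hs, hw⟩ := exists_eval_one_eq_sum (finrank ℝ E) hε
  refine ⟨s, w, hs, by simpa using (hw 1 (by simp)).symm, fun A => ?_⟩
  obtain ⟨p, hp, hpA⟩ := exists_polynomial_eval_eq_det_one_add_smul A
  simpa only [hpA, one_smul] using hw p hp

theorem det_one_add_pos_of_norm_lt_one {A : E →L[ℝ] E} (hA : ‖A‖ < 1) :
    0 < (1 + A).det := by
  have : CompleteSpace E := FiniteDimensional.complete ℝ E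
  have hcont : Continuous fun t : ℝ => (1 + t • A).det :=
    ContinuousLinearMap.continuous_det.comp (by fun_prop)
  have hne : ∀ t ∈ Icc (0 : ℝ) 1, (1 + t • A).det ≠ 0 := fun t ht => by
    have htA : ‖-(t • A)‖ < 1 := by
      rw [norm_neg, norm_smul, Real.norm_of_nonneg ht.1]
      exact (mul_le_of_le_one_left (norm_nonneg A) ht.2).trans_lt hA
    have hunit : IsUnit (1 + t • A) := by
      simpa using (Units.oneSub _ htA).isUnit
    exact (hunit.map ContinuousLinearMap.toLinearMapRingHom).map LinearMap.det |>.ne_zero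
  by_contra! hle
  obtain ⟨t, ht, h0⟩ := intermediate_value_Icc' zero_le_one hcont.continuousOn
    (show (0 : ℝ) ∈ Icc _ _ by
      simp only [zero_smul, one_smul, add_zero]
      exact ⟨hle, zero_le_one.trans_eq LinearMap.det_id.symm⟩)
  exact hne t ht h0

end Determinant

section Contraction

theorem inter_frontier_nonempty_of_isPreconnected {X : Type*} [TopologicalSpace X] {s t : Set X}
    (ht : IsPreconnected t) (hts : (t ∩ s).Nonempty) (htsc : (t ∩ sᶜ).Nonempty) :
    (t ∩ frontier s).Nonempty := by
  by_contra! hempty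
  have hcover : t ⊆ interior s ∪ interior sᶜ := by
    rw [← compl_frontier_eq_union_interior]
    exact disjoint_left.1 (disjoint_iff_inter_eq_empty.2 hempty)
  obtain ⟨x, hxt, hxs⟩ := hts
  obtain ⟨y, hyt, hys⟩ := htsc
  obtain ⟨z, -, hz, hzc⟩ := ht _ _ isOpen_interior isOpen_interior hcover
    ⟨x, hxt, (hcover hxt).resolve_right fun h => interior_subset h hxs⟩
    ⟨y, hyt, (hcover hyt).resolve_left fun h => hys (interior_subset h)⟩
  exact interior_subset hzc (interior_subset hz)

variable {E : Type*} [NormedAddCommGroup E]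

theorem lipschitzWith_indicator [NormedSpace ℝ E] {F : Type*} [SeminormedAddCommGroup F]
    {s : Set E} {f : E → F} {K : ℝ≥0} (hs : IsClosed s) (hf : LipschitzOnWith K f s)
    (h0 : ∀ x ∈ frontier s, f x = 0) : LipschitzWith K (s.indicator f) := by
  have hmixed : ∀ x ∈ s, ∀ y ∉ s, dist (f x) 0 ≤ K * dist x y := fun x hx y hy => by
    obtain ⟨z, hz, hzs⟩ := inter_frontier_nonempty_of_isPreconnected
      (convex_segment x y).isPreconnected ⟨x, left_mem_segment ℝ x y, hx⟩
      ⟨y, right_mem_segment ℝ x y, hy⟩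
    calc dist (f x) 0 = dist (f x) (f z) := by rw [h0 z hzs]
      _ ≤ K * dist x z := hf.dist_le_mul x hx z (hs.frontier_subset hzs)
      _ ≤ K * dist x y := by
        gcongr
        linarith [dist_add_dist_of_mem_segment hz, dist_nonneg (x := z) (y := y)]
  refine LipschitzWith.of_dist_le_mul fun x y => ?_
  by_cases hx : x ∈ s <;> by_cases hy : y ∈ s
  · simpa only [indicator_of_mem, hx, hy] using hf.dist_le_mul x hx y hy
  · simpa only [indicator_of_mem hx, indicator_of_notMem hy] using hmixed x hx y hy
  · simpa only [indicator_of_mem hy, indicator_of_notMem hx, dist_comm] using hmixed y hy x hx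
  · simpa only [indicator_of_notMem hx, indicator_of_notMem hy, dist_self] using by positivity

theorem bijective_id_add_of_lipschitzWith [CompleteSpace E] {h : E → E} {K : ℝ≥0}
    (hh : LipschitzWith K h) (hK : K < 1) : Bijective fun x => x + h x := by
  refine (bijective_iff_existsUnique _).2 fun y => ?_
  have hc : ContractingWith K fun x => y - h x :=
    ⟨hK, LipschitzWith.of_dist_le_mul fun a b => by
      rw [dist_sub_left]
      exact hh.dist_le_mul a b⟩
  exact ⟨hc.fixedPoint, (sub_eq_iff_eq_add.1 hc.fixedPoint_isFixedPt).symm,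
    fun x hx => hc.fixedPoint_unique (sub_eq_iff_eq_add.2 hx.symm)⟩

theorem bijOn_id_add_of_lipschitzOnWith [NormedSpace ℝ E] [CompleteSpace E]
    {s : Set E} {h : E → E} {K : ℝ≥0} (hs : IsClosed s) (hh : LipschitzOnWith K h s)
    (hK : K < 1) (h0 : ∀ x ∈ frontier s, h x = 0) : BijOn (fun x => x + h x) s s := by
  have hbij := bijective_id_add_of_lipschitzWith (lipschitzWith_indicator hs hh h0) hK
  have hcompl : BijOn (fun x => x + s.indicator h x) sᶜ sᶜ :=
    (bijOn_id sᶜ).congr fun x hx => by simp only [id, indicator_of_notMem hx, add_zero]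
  have := hcompl.compl hbij
  rw [compl_compl] at this
  exact this.congr fun x hx => by simp only [indicator_of_mem hx]

end Contraction

section VolumePreservation

variable {E : Type*} [NormedAddCommGroup E] [NormedSpace ℝ E] [FiniteDimensional ℝ E]

theorem integral_det_one_add_fderiv_of_norm_fderiv_lt_one [MeasurableSpace E] [BorelSpace E]
    (μ : Measure E) [μ.IsAddHaarMeasure] {s B : Set E} {h : E → E} {K : ℝ≥0} (hs : IsClosed s)
    (hB : Convex ℝ B) (hsB : s ⊆ B) (hh : Differentiable ℝ h)
    (hfd : ∀ x ∈ B, ‖fderiv ℝ h x‖₊ ≤ K) (hK : K < 1) (h0 : ∀ x ∈ frontier s, h x = 0) :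
    ∫ x in s, (1 + fderiv ℝ h x).det ∂μ = μ.real s := by
  have : CompleteSpace E := FiniteDimensional.complete ℝ E
  have hbij : BijOn (fun x => x + h x) s s := bijOn_id_add_of_lipschitzOnWith hs
    ((hB.lipschitzOnWith_of_nnnorm_fderiv_le (fun x _ => hh x) hfd).mono hsB) hK h0
  have hder : ∀ x ∈ s, HasFDerivWithinAt (fun x => x + h x) (1 + fderiv ℝ h x) s x :=
    fun x _ => ((hasFDerivAt_id x).add (hh x).hasFDerivAt).hasFDerivWithinAt
  have hpos : ∀ x ∈ s, 0 < (1 + fderiv ℝ h x).det := fun x hx =>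
    det_one_add_pos_of_norm_lt_one ((hfd x (hsB hx)).trans_lt hK)
  calc ∫ x in s, (1 + fderiv ℝ h x).det ∂μ
      = ∫ x in s, |(1 + fderiv ℝ h x).det| • (1 : ℝ) ∂μ :=
        setIntegral_congr_fun hs.measurableSet fun x hx => by
          rw [smul_eq_mul, mul_one, abs_of_pos (hpos x hx)]
    _ = ∫ _ in (fun x => x + h x) '' s, (1 : ℝ) ∂μ :=
        (integral_image_eq_integral_abs_det_fderiv_smul μ hs.measurableSet hder hbij.injOn
          fun _ => (1 : ℝ)).symm
    _ = μ.real s := by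
        rw [hbij.image_eq, integral_const, smul_eq_mul, mul_one, measureReal_restrict_apply_univ]

/- Both sides depend polynomially on `t` when `h` is replaced by `t • h`, and they agree for small
`t`, when `x ↦ x + t • h x` is a diffeomorphism of `s` onto itself. -/
theorem integral_det_one_add_fderiv [MeasurableSpace E] [BorelSpace E]
    (μ : Measure E) [μ.IsAddHaarMeasure] {s : Set E} {h : E → E} (hs : IsCompact s)
    (hh : ContDiff ℝ 1 h) (h0 : ∀ x ∈ frontier s, h x = 0) :
    ∫ x in s, (1 + fderiv ℝ h x).det ∂μ = μ.real s := by
  have hdiff : Differentiable ℝ h := hh.differentiable one_ne_zero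
  have hfd : Continuous (fderiv ℝ h) := hh.continuous_fderiv one_ne_zero
  obtain ⟨R, hsR⟩ := hs.isBounded.subset_closedBall 0
  obtain ⟨C, hC⟩ := (isCompact_closedBall (0 : E) R).bddAbove_image hfd.nnnorm.continuousOn
  obtain ⟨T, w, hT, hw, hdet⟩ :=
    exists_det_one_add_eq_sum E (show 0 < 1 / ((C : ℝ) + 1) by positivity)
  have hsmall : ∀ t ∈ T, ∫ x in s, (1 + t • fderiv ℝ h x).det ∂μ = μ.real s := fun t ht => by
    obtain ⟨ht0, htC⟩ := hT t ht
    have htfd : ∀ x, fderiv ℝ (t • h) x = t • fderiv ℝ h x := fun x =>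
      fderiv_const_smul (hdiff x) t
    have hsub : ‖t‖₊ * C < 1 := by
      rw [← NNReal.coe_lt_coe, NNReal.coe_mul, coe_nnnorm, Real.norm_of_nonneg ht0.le]
      rw [lt_div_iff₀ (by positivity), mul_add_one] at htC
      exact (lt_add_of_pos_right _ ht0).trans htC
    have := integral_det_one_add_fderiv_of_norm_fderiv_lt_one μ hs.isClosed
      (convex_closedBall 0 R) hsR (hdiff.const_smul t)
      (fun x hx => by
        rw [htfd, nnnorm_smul]
        exact mul_le_mul_right (hC (mem_image_of_mem _ hx)) _)
      hsub fun x hx => by rw [Pi.smul_apply, h0 x hx, smul_zero]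
    simpa only [htfd] using this
  calc ∫ x in s, (1 + fderiv ℝ h x).det ∂μ
      = ∫ x in s, ∑ t ∈ T, w t * (1 + t • fderiv ℝ h x).det ∂μ := by simp only [← hdet]
    _ = ∑ t ∈ T, w t * ∫ x in s, (1 + t • fderiv ℝ h x).det ∂μ := by
        rw [integral_finsetSum]
        · simp only [integral_const_mul]
        · exact fun t _ => (continuous_const.mul <| ContinuousLinearMap.continuous_det.comp <|
            continuous_const.add <| hfd.const_smul t).continuousOn.integrableOn_compact hs
    _ = μ.real s := by
        rw [Finset.sum_congr rfl fun t ht => by rw [hsmall t ht], ← Finset.sum_mul, hw, one_mul]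

end VolumePreservation

section BrouwerFixedPoint

variable {E : Type*} [NormedAddCommGroup E] [InnerProductSpace ℝ E]
  [FiniteDimensional ℝ E]

theorem det_fderiv_eq_zero_of_norm_eq {r : E → E} {x : E} {c : ℝ} (hr : DifferentiableAt ℝ r x)
    (hc : c ≠ 0) (hnorm : ∀ y, ‖r y‖ = c) : (fderiv ℝ r x).det = 0 := by
  by_contra hdet
  obtain ⟨v, hv⟩ : ∃ v, fderiv ℝ r x v = r x :=
    (LinearMap.equivOfDetNeZero (fderiv ℝ r x : E →ₗ[ℝ] E) hdet).surjective (r x)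
  have hderiv : HasFDerivAt (fun y => ‖r y‖ ^ 2) (2 • (innerSL ℝ (r x)).comp (fderiv ℝ r x)) x :=
    hr.hasFDerivAt.norm_sq
  simp only [hnorm] at hderiv
  have := congrArg (· v) (hderiv.unique (hasFDerivAt_const (c ^ 2) x))
  simp [hv, hnorm, hc] at this

theorem exists_mem_sphere_ne_of_norm_eq {r : E → E} {R : ℝ} (hr : ContDiff ℝ 1 r) (hR : 0 < R)
    (hnorm : ∀ x, ‖r x‖ = R) : ∃ x ∈ sphere (0 : E) R, r x ≠ x := by
  by_contra! hid
  borelize E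
  have hfd : ∀ x, 1 + fderiv ℝ (r - id) x = fderiv ℝ r x := fun x => by
    rw [fderiv_sub (hr.differentiable one_ne_zero x) differentiableAt_id, fderiv_id]
    exact add_sub_cancel _ _
  have hvol := integral_det_one_add_fderiv Measure.addHaar (h := r - id)
    (isCompact_closedBall (0 : E) R) (hr.sub contDiff_id) fun x hx => by
      rw [frontier_closedBall _ hR.ne'] at hx
      rw [Pi.sub_apply, hid x hx, id, sub_self]
  simp only [hfd, det_fderiv_eq_zero_of_norm_eq (hr.differentiable one_ne_zero _) hR.ne' hnorm,
    integral_zero] at hvol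
  exact (measureReal_ne_zero_iff measure_closedBall_lt_top.ne).2
    (measure_closedBall_pos _ 0 hR).ne' hvol.symm

theorem exists_eq_zero_of_eq_id_of_le_norm {v : E → E} {R : ℝ} (hv : Continuous v)
    (hid : ∀ x, R ≤ ‖x‖ → v x = x) : ∃ x, v x = 0 := by
  by_contra! hne
  let S := |R| + 1
  have hRS : R < S := (le_abs_self R).trans_lt (lt_add_one _)
  have hS : 0 < S := by positivity
  obtain ⟨g, hg, happrox, hgv, -⟩ := hv.exists_contDiff_approx_and_eqOn (ε := fun x => ‖v x‖) 1
    hv.norm (fun x => norm_pos_iff.2 (hne x)) (S := {x | S ≤ ‖x‖}) (U := {x | R < ‖x‖})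
    (isClosed_le continuous_const continuous_norm)
    ((isOpen_lt continuous_const continuous_norm).mem_nhdsSet.2 fun x hx => hRS.trans_le hx)
    (contDiffOn_id.congr fun x hx => hid x (le_of_lt hx))
  have hg0 : ∀ x, g x ≠ 0 := fun x h => by
    have := happrox x
    rw [h, dist_zero_left] at this
    exact lt_irrefl _ this
  obtain ⟨x, hx, hgx⟩ := exists_mem_sphere_ne_of_norm_eq (r := fun x => (S * ‖g x‖⁻¹) • g x)
    ((contDiff_const.mul ((hg.norm ℝ hg0).inv fun x => norm_ne_zero_iff.2 (hg0 x))).smul hg) hS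
    fun x => by
      rw [norm_smul, norm_mul, norm_inv, norm_norm,
        inv_mul_cancel_right₀ (norm_ne_zero_iff.2 (hg0 x)), Real.norm_of_nonneg hS.le]
  rw [mem_sphere_zero_iff_norm] at hx
  apply hgx
  rw [show g x = x from (hgv hx.ge).trans (hid x (hRS.le.trans hx.ge)), hx,
    mul_inv_cancel₀ hS.ne', one_smul]

theorem brouwer_exists_isFixedPt_closedBall {u : E → E} {R : ℝ} (hR : 0 < R)
    (hu : ContinuousOn u (closedBall 0 R)) (hmaps : MapsTo u (closedBall 0 R) (closedBall 0 R)) :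
    ∃ x ∈ closedBall (0 : E) R, IsFixedPt u x := by
  have := Metric.instTietzeExtensionClosedBall ℝ (0 : E) hR
  obtain ⟨w, hw⟩ := ContinuousMap.exists_restrict_eq isClosed_closedBall
    (⟨hmaps.restrict, hu.mapsToRestrict hmaps⟩ : C(closedBall (0 : E) R, closedBall (0 : E) R))
  have hwu : ∀ x ∈ closedBall (0 : E) R, (w x : E) = u x := fun x hx =>
    congrArg (fun k : C(closedBall (0 : E) R, closedBall (0 : E) R) => (k ⟨x, hx⟩ : E)) hw
  let a : E → ℝ := fun x => max 0 (min 1 (R + 1 - ‖x‖))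
  obtain ⟨x, hx⟩ := exists_eq_zero_of_eq_id_of_le_norm (v := fun x => x - a x • (w x : E))
    (R := R + 1) (by fun_prop) fun x hx => by
      have : a x = 0 := max_eq_left ((min_le_right _ _).trans (by linarith))
      rw [this, zero_smul, sub_zero]
  rw [sub_eq_zero] at hx
  have hxR : ‖x‖ ≤ R := by
    rw [hx, norm_smul, Real.norm_of_nonneg (le_max_left _ _)]
    exact (mul_le_of_le_one_left (norm_nonneg _) (max_le zero_le_one (min_le_left _ _))).trans
      (mem_closedBall_zero_iff.1 (w x).2)
  have hax : a x = 1 := by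
    simp only [a]
    rw [min_eq_left (by linarith), max_eq_right zero_le_one]
  rw [← mem_closedBall_zero_iff] at hxR
  rw [hax, one_smul, hwu x hxR] at hx
  exact ⟨x, hxR, hx.symm⟩

end BrouwerFixedPoint

section RadialPush

variable {E : Type*} [NormedAddCommGroup E] [NormedSpace ℝ E] {c y : E} {ε : ℝ}

/-- The radial map away from `c` that pushes the punctured ball of radius `ε` around `c` onto its
boundary sphere and fixes every point outside the ball. At `y = c` it takes the junk value `c`. -/
noncomputable def radialPush (c : E) (ε : ℝ) (y : E) : E := c + max (ε / dist y c) 1 • (y - c)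

theorem radialPush_of_le_dist (h : ε ≤ dist y c) : radialPush c ε y = y := by
  rw [radialPush, max_eq_right (div_le_one_of_le₀ h dist_nonneg), one_smul, add_sub_cancel]

theorem dist_radialPush_of_dist_le (hyc : y ≠ c) (h : dist y c ≤ ε) :
    dist (radialPush c ε y) c = ε := by
  have hd : 0 < dist y c := dist_pos.2 hyc
  rw [radialPush, max_eq_left ((one_le_div hd).2 h), dist_self_add_left, norm_smul,
    Real.norm_of_nonneg (div_nonneg (hd.le.trans h) hd.le), ← dist_eq_norm,
    div_mul_cancel₀ _ hd.ne']

theorem continuousOn_radialPush (c : E) (ε : ℝ) : ContinuousOn (radialPush c ε) {c}ᶜ := by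
  have hdist : ∀ y ∈ ({c}ᶜ : Set E), dist y c ≠ 0 := fun y hy => dist_ne_zero.2 hy
  unfold radialPush
  fun_prop (disch := exact hdist)

end RadialPush

section InvarianceOfDomain

universe u v

theorem exists_continuous_leftInvOn {X : Type u} {Y : Type v} [TopologicalSpace X]
    [TietzeExtension.{v} X] [TopologicalSpace Y] [NormalSpace Y] [T2Space Y] {f : X → Y}
    {s : Set X} (hs : IsCompact s) (hf : ContinuousOn f s) (hinj : InjOn f s) :
    ∃ G : Y → X, Continuous G ∧ LeftInvOn G f s := by
  have : CompactSpace s := isCompact_iff_compactSpace.1 hs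
  have hemb : IsClosedEmbedding (s.domRestrict f) :=
    hf.domRestrict.isClosedEmbedding hinj.injective
  obtain ⟨G, hG⟩ := ContinuousMap.exists_extension' hemb
    (⟨Subtype.val, continuous_subtype_val⟩ : C(s, X))
  exact ⟨G, G.continuous, fun x hx => congrFun hG ⟨x, hx⟩⟩

theorem exists_continuous_approx_forall_mem_ne_zero {E : Type*} [NormedAddCommGroup E]
    [NormedSpace ℝ E] [FiniteDimensional ℝ E] [MeasurableSpace E] [BorelSpace E] (μ : Measure E)
    [μ.IsAddHaarMeasure] {G : E → E} {s : Set E} {δ : ℝ} (hG : Continuous G) (hs : μ s = 0)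
    (hδ : 0 < δ) : ∃ P : E → E, Continuous P ∧ (∀ x, ‖P x - G x‖ < δ) ∧ ∀ x ∈ s, P x ≠ 0 := by
  obtain ⟨Q, hQ, hQG, -⟩ := hG.exists_contDiff_approx (ε := fun _ => δ / 2) 1 continuous_const
    fun _ => half_pos hδ
  have hnull : μ (Q '' s) = 0 := addHaar_image_eq_zero_of_differentiableOn_of_addHaar_eq_zero μ
    (hQ.differentiable one_ne_zero).differentiableOn hs
  obtain ⟨a, ha, haQ⟩ : ∃ a ∈ ball (0 : E) (δ / 2), a ∉ Q '' s :=
    not_subset.1 fun hsub =>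
      (measure_ball_pos μ 0 (half_pos hδ)).ne' (measure_mono_null hsub hnull)
  refine ⟨fun x => Q x - a, hQ.continuous.sub continuous_const, fun x => ?_,
    fun x hx h => haQ ⟨x, hx, sub_eq_zero.1 h⟩⟩
  calc ‖Q x - a - G x‖ = ‖Q x - G x - a‖ := by rw [sub_right_comm]
    _ ≤ ‖Q x - G x‖ + ‖a‖ := norm_sub_le _ _
    _ < δ / 2 + δ / 2 := add_lt_add (dist_eq_norm (Q x) (G x) ▸ hQG x) (mem_ball_zero_iff.1 ha)
    _ = δ := add_halves δ

variable {E : Type*} [NormedAddCommGroup E] [InnerProductSpace ℝ E] [FiniteDimensional ℝ E]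

theorem exists_mem_image_closedBall_eq_zero {Y : Type*} [TopologicalSpace Y] {f : E → Y}
    {G v : Y → E} {R : ℝ} (hR : 0 < R) (hf : ContinuousOn f (closedBall 0 R))
    (hGf : LeftInvOn G f (closedBall 0 R)) (hv : ContinuousOn v (f '' closedBall 0 R))
    (hvG : ∀ y ∈ f '' closedBall 0 R, ‖v y - G y‖ ≤ R) : ∃ y ∈ f '' closedBall 0 R, v y = 0 := by
  obtain ⟨x, hx, hfix⟩ := brouwer_exists_isFixedPt_closedBall (u := fun x => x - v (f x)) hR
    (continuousOn_id.sub (hv.comp hf (mapsTo_image _ _))) fun x hx => by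
      rw [mem_closedBall_zero_iff, norm_sub_rev]
      simpa only [hGf hx] using hvG (f x) (mem_image_of_mem f hx)
  exact ⟨f x, mem_image_of_mem f hx, sub_eq_self.1 hfix⟩

/- If `c` is not attained, then pushing away from `c` and perturbing `G` to avoid `0` on the sphere
around `c` yields a map close to `G` without zeros on the image of `f`. -/
theorem mem_image_closedBall_of_leftInvOn {f G : E → E} {c : E} {R ε : ℝ} (hR : 0 < R)
    (hf : ContinuousOn f (closedBall 0 R)) (hG : Continuous G)
    (hGf : LeftInvOn G f (closedBall 0 R)) (h0 : f 0 ∈ ball c ε)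
    (hGε : ∀ y ∈ closedBall c ε, ‖G y‖ ≤ R / 3) : c ∈ f '' closedBall 0 R := by
  by_contra hc
  borelize E
  have hε : 0 < ε := dist_nonneg.trans_lt h0
  have hne : ∀ y ∈ f '' closedBall 0 R, y ≠ c := fun y hy h => hc (h ▸ hy)
  obtain ⟨δ, hδ, hδG⟩ : ∃ δ > 0, ∀ y ∈ f '' closedBall 0 R \ ball c ε, δ ≤ ‖G y‖ := by
    have hK : IsCompact (f '' closedBall 0 R) := (isCompact_closedBall 0 R).image_of_continuousOn hf
    refine (hK.diff isOpen_ball).exists_forall_le' hG.norm.continuousOn ?_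
    rintro _ ⟨⟨x, hx, rfl⟩, hxc⟩
    rw [hGf hx, norm_pos_iff]
    rintro rfl
    exact hxc h0
  obtain ⟨P, hP, hPG, hP0⟩ := exists_continuous_approx_forall_mem_ne_zero Measure.addHaar hG
    (Measure.addHaar_sphere_of_ne_zero _ c hε.ne') (lt_min hδ (by positivity : 0 < R / 3))
  have hpush : ContinuousOn (fun y => P (radialPush c ε y)) (f '' closedBall 0 R) :=
    hP.comp_continuousOn ((continuousOn_radialPush c ε).mono hne)
  obtain ⟨y, hy, hy0⟩ := exists_mem_image_closedBall_eq_zero hR hf hGf hpush fun y hy => by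
    have hPG' := fun z => (hPG z).le.trans (min_le_right _ _)
    rcases le_or_gt ε (dist y c) with hfar | hnear
    · rw [radialPush_of_le_dist hfar]
      exact (hPG' y).trans (by linarith)
    · have hz := hGε _ (dist_radialPush_of_dist_le (hne y hy) hnear.le).le
      have hy := hGε y hnear.le
      have hPz := hPG' (radialPush c ε y)
      calc ‖P (radialPush c ε y) - G y‖
          ≤ ‖P (radialPush c ε y) - G (radialPush c ε y)‖ + ‖G (radialPush c ε y) - G y‖ :=
            norm_sub_le_norm_sub_add_norm_sub _ _ _
        _ ≤ R / 3 + (R / 3 + R / 3) :=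
            add_le_add hPz ((norm_sub_le _ _).trans (add_le_add hz hy))
        _ = R := by ring
  rcases le_or_gt ε (dist y c) with hfar | hnear
  · have h := (hPG y).trans_le ((min_le_left _ _).trans (hδG y ⟨hy, hfar.not_gt⟩))
    rw [radialPush_of_le_dist hfar] at hy0
    rw [hy0, zero_sub, norm_neg] at h
    exact lt_irrefl _ h
  · exact hP0 _ (dist_radialPush_of_dist_le (hne y hy) hnear.le) hy0

theorem mem_interior_image_closedBall {f : E → E} {R : ℝ} (hR : 0 < R)
    (hf : ContinuousOn f (closedBall 0 R)) (hinj : InjOn f (closedBall 0 R)) :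
    f 0 ∈ interior (f '' closedBall 0 R) := by
  obtain ⟨G, hG, hGf⟩ := exists_continuous_leftInvOn (isCompact_closedBall 0 R) hf hinj
  have hG0 : ‖G (f 0)‖ < R / 3 := by
    rw [hGf (mem_closedBall_self hR.le), norm_zero]
    positivity
  obtain ⟨ε, hε, hGε⟩ := Metric.nhds_basis_closedBall.eventually_iff.1
    (hG.norm.continuousAt.eventually_lt_const hG0)
  refine mem_interior.2 ⟨ball (f 0) (ε / 2), fun c hc => ?_, isOpen_ball,
    mem_ball_self (half_pos hε)⟩
  refine mem_image_closedBall_of_leftInvOn hR hf hG hGf (mem_ball_comm.1 hc) fun y hy =>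
    (hGε (closedBall_subset_closedBall' ?_ hy)).le
  linarith [mem_ball.1 hc]

theorem isOpen_image_of_continuousOn_injOn {f : E → E} {U : Set E} (hU : IsOpen U)
    (hf : ContinuousOn f U) (hinj : InjOn f U) : IsOpen (f '' U) := by
  rw [← subset_interior_iff_isOpen]
  rintro _ ⟨x, hx, rfl⟩
  obtain ⟨R, hR, hRU⟩ := Metric.nhds_basis_closedBall.mem_iff.1 (hU.mem_nhds hx)
  have hmaps : MapsTo (x + ·) (closedBall 0 R) U := fun z hz =>
    hRU (by simpa only [mem_closedBall, dist_self_add_left, dist_zero_right] using hz)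
  have hmem := mem_interior_image_closedBall (f := f ∘ (x + ·)) hR
    (hf.comp (by fun_prop) hmaps) (hinj.comp (add_right_injective x).injOn hmaps)
  rw [comp_apply, add_zero, image_comp] at hmem
  exact interior_mono (image_mono hmaps.image_subset) hmem

theorem isOpen_image_of_finrank_eq {V W : Type*} [NormedAddCommGroup V] [NormedSpace ℝ V]
    [FiniteDimensional ℝ V] [NormedAddCommGroup W] [NormedSpace ℝ W] [FiniteDimensional ℝ W]
    (hVW : finrank ℝ V = finrank ℝ W) {f : V → W} {U : Set V} (hU : IsOpen U)
    (hf : ContinuousOn f U) (hinj : InjOn f U) : IsOpen (f '' U) := by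
  let e : V ≃L[ℝ] EuclideanSpace ℝ (Fin (finrank ℝ W)) :=
    ContinuousLinearEquiv.ofFinrankEq (by rw [finrank_euclideanSpace_fin, hVW])
  let e' : W ≃L[ℝ] EuclideanSpace ℝ (Fin (finrank ℝ W)) :=
    ContinuousLinearEquiv.ofFinrankEq finrank_euclideanSpace_fin.symm
  have hmaps : MapsTo e.symm (e.symm ⁻¹' U) U := mapsTo_preimage _ _
  have h := isOpen_image_of_continuousOn_injOn (f := e' ∘ f ∘ e.symm)
    (hU.preimage e.symm.continuous) (e'.continuous.comp_continuousOn
      (hf.comp e.symm.continuous.continuousOn hmaps))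
    (e'.injective.comp_injOn (hinj.comp e.symm.injective.injOn hmaps))
  rw [image_comp, image_comp, image_preimage_eq _ e.symm.surjective] at h
  exact e'.toHomeomorph.isOpen_image.1 h

end InvarianceOfDomain

section HopfFibration

theorem inner_hopfVec (p v : EuclideanSpace ℂ (Fin 2)) :
    inner ℝ (hopfVec p) (hopfVec v) = 2 * ‖inner ℂ p v‖ ^ 2 - ‖p‖ ^ 2 * ‖v‖ ^ 2 := by
  simp only [EuclideanSpace.norm_sq_eq, PiLp.inner_apply, RCLike.inner_apply, Fin.sum_univ_two,
    Fin.sum_univ_three, hopfVec, Matrix.cons_val, conj_trivial, Complex.sq_norm,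
    Complex.normSq_apply, Complex.add_re, Complex.add_im, Complex.mul_re, Complex.mul_im,
    Complex.conj_re, Complex.conj_im]
  ring

theorem hopfVec_smul (c : ℂ) (p : EuclideanSpace ℂ (Fin 2)) :
    hopfVec (c • p) = ‖c‖ ^ 2 • hopfVec p := by
  have hprod : c * p 0 * starRingEnd ℂ (c * p 1) =
      (‖c‖ ^ 2 : ℝ) * (p 0 * starRingEnd ℂ (p 1)) := by
    rw [map_mul, mul_mul_mul_comm, Complex.mul_conj, Complex.normSq_eq_norm_sq]
  ext i
  fin_cases i
  · change 2 * (c * p 0 * starRingEnd ℂ (c * p 1)).re = ‖c‖ ^ 2 * (2 * _)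
    rw [hprod, Complex.re_ofReal_mul, mul_left_comm]
  · change 2 * (c * p 0 * starRingEnd ℂ (c * p 1)).im = ‖c‖ ^ 2 * (2 * _)
    rw [hprod, Complex.im_ofReal_mul, mul_left_comm]
  · change ‖c * p 0‖ ^ 2 - ‖c * p 1‖ ^ 2 = ‖c‖ ^ 2 * (‖p 0‖ ^ 2 - ‖p 1‖ ^ 2)
    rw [norm_mul, norm_mul, mul_pow, mul_pow, mul_sub]

theorem hopfVec_normalize {v : EuclideanSpace ℂ (Fin 2)} {b : EuclideanSpace ℝ (Fin 3)}
    (hv : v ≠ 0) (h : hopfVec v = ‖v‖ ^ 2 • b) : hopfVec (NormedSpace.normalize v) = b := by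
  rw [NormedSpace.normalize, RCLike.real_smul_eq_coe_smul (K := ℂ), hopfVec_smul, h, smul_smul,
    RCLike.norm_ofReal, sq_abs, ← mul_pow, inv_mul_cancel₀ (norm_ne_zero_iff.2 hv), one_pow,
    one_smul]

theorem exists_hopfVec_eq_smul (b : S2) :
    ∃ v : EuclideanSpace ℂ (Fin 2), v ≠ 0 ∧ hopfVec v = ‖v‖ ^ 2 • b.1 := by
  have hb : b.1 0 ^ 2 + b.1 1 ^ 2 + b.1 2 ^ 2 = 1 := by
    simpa [Fin.sum_univ_three] using (EuclideanSpace.norm_sq_eq b.1).symm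
  by_cases hpole : b.1 2 = 1
  · have h0 : b.1 0 = 0 := by nlinarith
    have h1 : b.1 1 = 0 := by nlinarith
    refine ⟨EuclideanSpace.single 0 1, by simp, ?_⟩
    ext i
    fin_cases i <;> simp [hopfVec, hpole, h0, h1]
  · let ζ : ℂ := ⟨b.1 0, b.1 1⟩
    let v : EuclideanSpace ℂ (Fin 2) := !₂[ζ, (1 - b.1 2 : ℝ)]
    have hζ : ‖ζ‖ ^ 2 = 1 - b.1 2 ^ 2 := by
      rw [Complex.sq_norm, Complex.normSq_mk]
      linear_combination hb
    have hr : ‖((1 - b.1 2 : ℝ) : ℂ)‖ ^ 2 = (1 - b.1 2) ^ 2 := by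
      rw [Complex.norm_real, Real.norm_eq_abs, sq_abs]
    have hv : ‖v‖ ^ 2 = 2 * (1 - b.1 2) := by
      rw [EuclideanSpace.norm_sq_eq, Fin.sum_univ_two]
      change ‖ζ‖ ^ 2 + ‖((1 - b.1 2 : ℝ) : ℂ)‖ ^ 2 = 2 * (1 - b.1 2)
      rw [hζ, hr]
      ring
    refine ⟨v, fun h => hpole ?_, ?_⟩
    · rw [h, norm_zero] at hv
      linarith
    rw [hv]
    ext i
    fin_cases i
    · change 2 * (ζ * starRingEnd ℂ (1 - b.1 2 : ℝ)).re = 2 * (1 - b.1 2) * b.1 0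
      rw [Complex.conj_ofReal, Complex.re_mul_ofReal]
      ring
    · change 2 * (ζ * starRingEnd ℂ (1 - b.1 2 : ℝ)).im = 2 * (1 - b.1 2) * b.1 1
      rw [Complex.conj_ofReal, Complex.im_mul_ofReal]
      ring
    · change ‖ζ‖ ^ 2 - ‖((1 - b.1 2 : ℝ) : ℂ)‖ ^ 2 = 2 * (1 - b.1 2) * b.1 2
      rw [hζ, hr]
      ring

theorem hopfMap_surjective : Surjective hopfMap := fun b =>
  have ⟨_, hv, hvb⟩ := exists_hopfVec_eq_smul b
  ⟨⟨_, mem_sphere_zero_iff_norm.2 (NormedSpace.norm_normalize hv)⟩,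
    Subtype.ext (hopfVec_normalize hv hvb)⟩

/-- For `b` in the unit sphere, `fiberProj b` is the orthogonal projection of `ℂ²` onto the complex
line spanned by the Hopf fibre over `b`. It is polynomial in `b`, hence continuous in `(b, v)`. -/
noncomputable def fiberProj (b : EuclideanSpace ℝ (Fin 3)) (v : EuclideanSpace ℂ (Fin 2)) :
    EuclideanSpace ℂ (Fin 2) :=
  !₂[((1 + b 2 : ℝ) * v 0 + (⟨b 0, b 1⟩ : ℂ) * v 1) / 2,
    ((⟨b 0, -b 1⟩ : ℂ) * v 0 + (1 - b 2 : ℝ) * v 1) / 2]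

theorem continuous_fiberProj : Continuous fun x : EuclideanSpace ℝ (Fin 3) ×
    EuclideanSpace ℂ (Fin 2) => fiberProj x.1 x.2 := by
  simp only [fiberProj, Complex.mk_eq_add_mul_I]
  fun_prop

theorem fiberProj_hopfVec {p : EuclideanSpace ℂ (Fin 2)} (hp : ‖p‖ = 1)
    (v : EuclideanSpace ℂ (Fin 2)) : fiberProj (hopfVec p) v = inner ℂ p v • p := by
  have hnorm (z : ℂ) : ((‖z‖ ^ 2 : ℝ) : ℂ) = z * starRingEnd ℂ z := by
    rw [Complex.mul_conj, Complex.normSq_eq_norm_sq]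
  have hp' : p 0 * starRingEnd ℂ (p 0) + p 1 * starRingEnd ℂ (p 1) = 1 := by
    rw [← hnorm, ← hnorm, ← Complex.ofReal_add, ← Fin.sum_univ_two (fun i => ‖p i‖ ^ 2),
      ← EuclideanSpace.norm_sq_eq, hp, one_pow, Complex.ofReal_one]
  have hz : (⟨hopfVec p 0, hopfVec p 1⟩ : ℂ) = 2 * (p 0 * starRingEnd ℂ (p 1)) :=
    Complex.ext (by simp [hopfVec]) (by simp [hopfVec])
  have hz' : (⟨hopfVec p 0, -hopfVec p 1⟩ : ℂ) = 2 * (p 1 * starRingEnd ℂ (p 0)) :=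
    Complex.ext (by simp [hopfVec, mul_comm]) (by simp [hopfVec]; ring)
  have ht : ((hopfVec p 2 : ℝ) : ℂ) = p 0 * starRingEnd ℂ (p 0) - p 1 * starRingEnd ℂ (p 1) := by
    rw [← hnorm, ← hnorm, ← Complex.ofReal_sub]
    rfl
  ext i
  rw [fiberProj, hz, hz', PiLp.smul_apply, PiLp.inner_apply, Fin.sum_univ_two,
    Complex.ofReal_add, Complex.ofReal_sub, ht, Complex.ofReal_one, smul_eq_mul]
  fin_cases i
  · change (_ + _) / 2 = (v 0 * starRingEnd ℂ (p 0) + v 1 * starRingEnd ℂ (p 1)) * p 0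
    linear_combination -v 0 / 2 * hp'
  · change (_ + _) / 2 = (v 0 * starRingEnd ℂ (p 0) + v 1 * starRingEnd ℂ (p 1)) * p 1
    linear_combination -v 1 / 2 * hp'

theorem hopfVec_fiberProj (b : S2) (v : EuclideanSpace ℂ (Fin 2)) :
    hopfVec (fiberProj b v) = ‖fiberProj b v‖ ^ 2 • b.1 := by
  obtain ⟨p, rfl⟩ := hopfMap_surjective b
  have hp : ‖p.1‖ = 1 := norm_eq_of_mem_sphere p
  change hopfVec (fiberProj (hopfVec p) v) = ‖fiberProj (hopfVec p) v‖ ^ 2 • hopfVec p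
  rw [fiberProj_hopfVec hp, hopfVec_smul, norm_smul, hp, mul_one]

theorem fiberProj_ne_zero {b : S2} {v : S3} (h : b ≠ -hopfMap v) : fiberProj b v ≠ 0 := by
  obtain ⟨p, rfl⟩ := hopfMap_surjective b
  have hp : ‖p.1‖ = 1 := norm_eq_of_mem_sphere p
  change fiberProj (hopfVec p) v ≠ 0
  rw [fiberProj_hopfVec hp]
  refine smul_ne_zero (fun h0 => h (Subtype.ext ?_)) (ne_zero_of_mem_unit_sphere p)
  refine (inner_eq_neg_one_iff_of_norm_eq_one (𝕜 := ℝ) (norm_eq_of_mem_sphere (hopfMap p))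
    (norm_eq_of_mem_sphere (hopfMap v))).1 ?_
  change inner ℝ (hopfVec p) (hopfVec v) = -1
  rw [inner_hopfVec, h0, hp, norm_eq_of_mem_sphere v]
  norm_num

theorem eq_inner_smul_of_hopfMap_eq {p p' : S3} (h : hopfMap p = hopfMap p') :
    p'.1 = inner ℂ p.1 p'.1 • p.1 := by
  have hp : ‖p.1‖ = 1 := norm_eq_of_mem_sphere p
  have hp' : ‖p'.1‖ = 1 := norm_eq_of_mem_sphere p'
  have hv : hopfVec p'.1 = hopfVec p.1 := congrArg Subtype.val h.symm
  rw [← fiberProj_hopfVec hp, ← hv, fiberProj_hopfVec hp', inner_self_eq_norm_sq_to_K, hp',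
    RCLike.ofReal_one, one_pow, one_smul]

end HopfFibration

section Lift

variable {X : Type*} [TopologicalSpace X]

theorem exists_lift_of_forall_ne_neg {k : C(X, S2)} {G : C(X, S3)}
    (h : ∀ x, k x ≠ -hopfMap (G x)) : ∃ G' : C(X, S3), ∀ x, hopfMap (G' x) = k x := by
  let v : X → EuclideanSpace ℂ (Fin 2) := fun x => fiberProj (k x) (G x)
  have hv0 : ∀ x, v x ≠ 0 := fun x => fiberProj_ne_zero (h x)
  have hv : Continuous v := continuous_fiberProj.comp (f := fun x => ((k x).1, (G x).1))
    (by fun_prop)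
  refine ⟨⟨fun x => ⟨NormedSpace.normalize (v x),
    mem_sphere_zero_iff_norm.2 (NormedSpace.norm_normalize (hv0 x))⟩, ?_⟩,
    fun x => Subtype.ext (hopfVec_normalize (hv0 x) (hopfVec_fiberProj (k x) (G x)))⟩
  exact ((hv.norm.inv₀ fun x => norm_ne_zero_iff.2 (hv0 x)).smul hv).subtype_mk _

theorem isClopen_setOf_exists_lift [CompactSpace X] :
    IsClopen {k : C(X, S2) | ∃ G : C(X, S3), ∀ x, hopfMap (G x) = k x} := by
  have hstable : ∀ k k' : C(X, S2), dist k' k < 2 → (∃ G : C(X, S3), ∀ x, hopfMap (G x) = k x) →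
      ∃ G : C(X, S3), ∀ x, hopfMap (G x) = k' x := by
    rintro k k' hkk' ⟨G, hG⟩
    refine exists_lift_of_forall_ne_neg (G := G) fun x hx => ?_
    have hdist : dist (k' x) (k x) = 2 := by
      rw [hx, hG, Subtype.dist_eq, coe_neg_sphere, dist_eq_norm, ← neg_add', norm_neg, ← two_smul ℝ,
        norm_smul, norm_eq_of_mem_sphere, Real.norm_two, mul_one]
    exact ((ContinuousMap.dist_apply_le_dist x).trans_lt hkk').ne hdist
  refine ⟨isClosed_of_closure_subset fun k hk => ?_,
    Metric.isOpen_iff.2 fun k hk => ⟨2, two_pos, fun k' hk' => hstable k k' hk' hk⟩⟩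
  obtain ⟨k', hk', hkk'⟩ := Metric.mem_closure_iff.1 hk 2 two_pos
  exact hstable k' k hkk' hk'

theorem exists_lift_of_nullhomotopic [CompactSpace X] {k : C(X, S2)} (hk : k.Nullhomotopic) :
    ∃ G : C(X, S3), ∀ x, hopfMap (G x) = k x := by
  obtain ⟨b, ⟨H⟩⟩ := hk
  obtain ⟨p, hp⟩ := hopfMap_surjective b
  have hmem := isClopen_setOf_exists_lift (X := X)
  have hconst : ContinuousMap.const X b ∈
      {k : C(X, S2) | ∃ G : C(X, S3), ∀ x, hopfMap (G x) = k x} := ⟨.const X p, fun _ => hp⟩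
  have hrange := (isPreconnected_range H.curry.continuous).subset_isClopen hmem
    ⟨_, ⟨1, by ext1 x; simp⟩, hconst⟩
  exact hrange ⟨0, by ext1 x; simp⟩

theorem exists_circle_exp_lift_of_nullhomotopic {u : C(X, Circle)} (hu : u.Nullhomotopic) :
    ∃ θ : C(X, ℝ), ∀ x, Circle.exp (θ x) = u x := by
  obtain ⟨z, ⟨H⟩⟩ := hu
  obtain ⟨s, hs⟩ := Circle.exp_surjective z
  have hH : ∀ x, H.symm (0, x) = Circle.exp (ContinuousMap.const X s x) := fun x => by simp [hs]
  let Θ := Circle.isCoveringMap_exp.liftHomotopy H.symm.toContinuousMap (.const X s) hH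
  refine ⟨Θ.comp ⟨fun x => (1, x), by fun_prop⟩, fun x => ?_⟩
  have h := congrFun (Circle.isCoveringMap_exp.liftHomotopy_lifts H.symm.toContinuousMap
    (.const X s) hH) (1, x)
  exact h.trans (H.symm.apply_one x)

theorem exists_angle_of_hopfMap_comp_eq [ContractibleSpace X] {p p' : C(X, S3)}
    (h : ∀ x, hopfMap (p x) = hopfMap (p' x)) :
    ∃ θ : C(X, ℝ), ∀ x, (p' x).1 = (Circle.exp (θ x) : ℂ) • (p x).1 := by
  have hphase : ∀ x, (p' x).1 = inner ℂ (p x).1 (p' x).1 • (p x).1 := fun x =>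
    eq_inner_smul_of_hopfMap_eq (h x)
  have hnorm : ∀ x, inner ℂ (p x).1 (p' x).1 ∈ Submonoid.unitSphere ℂ := fun x => by
    have := congrArg norm (hphase x)
    rw [norm_smul, norm_eq_of_mem_sphere, norm_eq_of_mem_sphere, mul_one] at this
    exact mem_sphere_zero_iff_norm.2 this.symm
  let u : C(X, Circle) := ⟨fun x => ⟨inner ℂ (p x).1 (p' x).1, hnorm x⟩, by fun_prop⟩
  obtain ⟨θ, hθ⟩ := exists_circle_exp_lift_of_nullhomotopic ((id_nullhomotopic X).comp_right u)
  exact ⟨θ, fun x => by rw [hθ]; exact hphase x⟩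

theorem exists_angle_of_factorization {E : Type*} [TopologicalSpace E] [ContractibleSpace E]
    [CompactSpace X] [ContractibleSpace X] {q : C(X, S3)} {f' : C(X, E)} {g : C(E, S2)}
    (h : ∀ x, hopfMap (q x) = g (f' x)) :
    ∃ θ : C(X, ℝ), ∀ x y, f' x = f' y → θ x = θ y → q x = q y := by
  have : CompactSpace (range f') := isCompact_iff_compactSpace.1 (isCompact_range f'.continuous)
  let ι : C(range f', E) := ⟨Subtype.val, continuous_subtype_val⟩
  let φ : C(X, range f') := ⟨rangeFactorization f', by fun_prop⟩
  obtain ⟨G, hG⟩ := exists_lift_of_nullhomotopic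
    (((id_nullhomotopic E).comp_right g).comp_left ι)
  obtain ⟨θ, hθ⟩ := exists_angle_of_hopfMap_comp_eq (p := G.comp φ) (p' := q) fun x =>
    (hG (φ x)).trans (h x).symm
  refine ⟨θ, fun x y hf hθxy => Subtype.ext ?_⟩
  have hφ : φ x = φ y := Subtype.ext hf
  rw [hθ, hθ, hθxy, ContinuousMap.comp_apply, ContinuousMap.comp_apply, hφ]

end Lift

section Factorization

theorem exists_mk_mem_notMem_of_isOpen {Y Z : Type*} [TopologicalSpace Y] [TopologicalSpace Z]
    [T2Space Y] [T2Space Z] [PreconnectedSpace Z] [NoncompactSpace Z] {C W : Set (Y × Z)}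
    (hC : IsCompact C) (hW : IsOpen W) (hWC : W ⊆ C) {y : Y} {z : Z} (hyz : (y, z) ∈ C) :
    ∃ z', (y, z') ∈ C \ W := by
  by_contra! h
  have hslice : Prod.mk y ⁻¹' W = Prod.mk y ⁻¹' C :=
    Subset.antisymm (preimage_mono hWC) fun z' hz' => by_contra fun hz'W => h z' ⟨hz', hz'W⟩
  have hmk : Continuous (Prod.mk y : Z → Y × Z) := Continuous.prodMk_right y
  have hclopen : IsClopen (Prod.mk y ⁻¹' C) :=
    ⟨hC.isClosed.preimage hmk, hslice ▸ hW.preimage hmk⟩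
  have hC_all : ∀ z', (y, z') ∈ C := eq_univ_iff_forall.1 (hclopen.eq_univ ⟨z, hyz⟩)
  refine noncompact_univ Z ((hC.image continuous_snd).of_isClosed_subset isClosed_univ ?_)
  exact fun z' _ => ⟨(y, z'), hC_all z', rfl⟩

theorem exists_forall_mem_hopfMap_ne {K : Type*} [TopologicalSpace K] {q : K → S3} {A : Set K}
    (hq : IsCollapse A q) : ∃ x₀, ∀ x ∈ A, hopfMap (q x) ≠ hopfMap (q x₀) := by
  have hsurj : Surjective (hopfMap ∘ q) := hopfMap_surjective.comp hq.isQuotientMap.surjective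
  rcases A.eq_empty_or_nonempty with rfl | ⟨c, hc⟩
  · obtain ⟨b, hb⟩ : (sphere (0 : EuclideanSpace ℝ (Fin 3)) 1).Nonempty :=
      NormedSpace.sphere_nonempty.2 zero_le_one
    obtain ⟨x₀, -⟩ := hsurj ⟨b, hb⟩
    exact ⟨x₀, fun x hx => hx.elim⟩
  · obtain ⟨x₀, hx₀⟩ := hsurj (-hopfMap (q c))
    refine ⟨x₀, fun x hx => ?_⟩
    rw [(hq.eq_iff x c).2 (.inr ⟨hx, hc⟩)]
    exact fun h => ne_neg_of_mem_unit_sphere ℝ (hopfMap (q c)) (h.trans hx₀)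

theorem not_factorsOver_hopfMap_comp {K V : Type*} [TopologicalSpace K] [CompactSpace K]
    [ContractibleSpace K] [NormedAddCommGroup V] [NormedSpace ℝ V] [FiniteDimensional ℝ V] {d : ℕ}
    (hV : finrank ℝ V = d + 1) {q : K → S3} (hq : Continuous q) {s : V → K} (hs : Continuous s)
    (hqs : Injective (q ∘ s)) {x₀ : K} (hx₀ : ∀ x, hopfMap (q x) = hopfMap (q x₀) → x ∈ range s) :
    ¬ FactorsOver d (hopfMap ∘ q) := by
  rintro ⟨f', g, hf', hg, hfg⟩
  have hfactor : ∀ x, hopfMap (q x) = g (f' x) := congrFun hfg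
  obtain ⟨θ, hθ⟩ := exists_angle_of_factorization (q := ⟨q, hq⟩) (f' := ⟨f', hf'⟩) (g := ⟨g, hg⟩)
    hfactor
  let F : K → EuclideanSpace ℝ (Fin d) × ℝ := fun x => (f' x, θ x)
  have hF : Continuous F := hf'.prodMk θ.continuous
  have hFs : Injective (F ∘ s) := fun v w hvw =>
    hqs (hθ _ _ (congrArg Prod.fst hvw) (congrArg Prod.snd hvw))
  have hopen : IsOpen (range (F ∘ s)) := by
    rw [← image_univ]
    exact isOpen_image_of_finrank_eq (by simp [hV]) isOpen_univ (hF.comp hs).continuousOn hFs.injOn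
  obtain ⟨_, ⟨x, hx⟩, hnot⟩ := exists_mk_mem_notMem_of_isOpen (isCompact_range hF) hopen
    (range_comp_subset_range s F) (mem_range_self x₀)
  have hfx : f' x = f' x₀ := congrArg Prod.fst hx
  obtain ⟨v, rfl⟩ := hx₀ x (by rw [hfactor, hfactor, hfx])
  exact hnot ⟨v, hx⟩

theorem range_softmax (n : ℕ) : range (softmax n) = (simplexBoundary n)ᶜ := by
  rw [← image_univ]
  exact (softmax n).image_source_eq_target

instance contractibleSpace_simplex (n : ℕ) : ContractibleSpace (Simplex n) :=
  (convex_stdSimplex ℝ _).contractibleSpace ⟨_, single_mem_stdSimplex ℝ 0⟩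

end Factorization

end HopfSimplex

theorem mainTheorem5_general {K V : Type*} [TopologicalSpace K] [CompactSpace K]
    [ContractibleSpace K] [NormedAddCommGroup V] [NormedSpace ℝ V] [FiniteDimensional ℝ V]
    (hV : Module.finrank ℝ V = 3) {A : Set K} {q : K → HopfSimplex.S3}
    (hq : HopfSimplex.IsCollapse A q) {s : V → K} (hs : Continuous s)
    (hsinj : Function.Injective s) (hsA : Set.range s = Aᶜ) :
    ¬ HopfSimplex.FactorsOver 2 (HopfSimplex.hopfMap ∘ q) := by
  obtain ⟨x₀, hx₀⟩ := HopfSimplex.exists_forall_mem_hopfMap_ne hq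
  have hsA' : ∀ v, s v ∉ A := fun v => hsA.subset (Set.mem_range_self v)
  have hqs : Function.Injective (q ∘ s) := fun v w hvw =>
    hsinj (((hq.eq_iff _ _).1 hvw).resolve_right fun h => hsA' v h.1)
  exact HopfSimplex.not_factorsOver_hopfMap_comp hV hq.isQuotientMap.continuous hs hqs
    fun x hx => hsA ▸ fun hxA => hx₀ x hxA hx

theorem mainTheorem5 (q : HopfSimplex.Simplex 3 → HopfSimplex.S3)
    (hq : HopfSimplex.IsCollapse (HopfSimplex.simplexBoundary 3) q) :
    ¬ HopfSimplex.FactorsOver 2 (HopfSimplex.hopfMap ∘ q) := by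
  have hs : Topology.IsOpenEmbedding (HopfSimplex.softmax 3) :=
    (HopfSimplex.softmax 3).isOpenEmbedding rfl
  exact mainTheorem5_general (Module.finrank_fin_fun ℝ) hq hs.continuous hs.injective
    (HopfSimplex.range_softmax 3)
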